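/- Let $n,N$ be natural numbers with $2\le n\le N$ and let $z_1,\dots,z_N\in\mathbb{C}$ satisfy $|z_j|\le 1$ for all $j$. Put $\widetilde z=\frac1N\sum_{j=1}^N z_j$ and $$E_{[N],n}=\sum_{J\subseteq\{1,\dots,N\},\ |J|=n}\ \prod_{j\in J}z_j .$$ Let $$\kappa=\frac{1}{N-2}\max_{1\le u,v\le N,\ u\ne v}\ \sum_{j\in\{1,\dots,N\}\setminus\{u,v\}}|z_j|^2\quad\text{if } n\ge 3,\qquad \kappa=1\quad\text{if } n=2,$$ and for real $x_1,x_2$ let $$f_n(x_1,x_2)=\sum_{k=2}^n (k-1)\,x_1^{\,n-k}x_2^{\,k-2}\qquad(\text{with } 0^0=1).$$ Then $$\left|\frac{E_{[N],n}}{\binom{N}{n}}-\widetilde z^{\,n}\right|\le\frac{f_n(|\widetilde z|,\sqrt{\kappa})}{N(N-1)}\sum_{j=1}^N|z_j-\widetilde z|^2\le\frac{n(n-1)}{N(N-1)}\sum_{j=1}^N|z_j-\widetilde z|^2\ \min\left\{\frac12,\ \frac{1}{n(1-|\widetilde z|)}\right\},$$ where $\frac10=\infty$, so that the minimum equals $\frac12$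 if $|\widetilde z|=1$. -/

import Mathlib

noncomputable section

namespace SymmMeans

/-- `f_n(x₁, x₂) = ∑_{k=2}^n (k-1) x₁^{n-k} x₂^{k-2}` (with `0 ^ 0 = 1`). -/
def f (n : ℕ) (x₁ x₂ : ℝ) : ℝ :=
  ∑ k ∈ Finset.Icc 2 n, ((k : ℝ) - 1) * x₁ ^ (n - k) * x₂ ^ (k - 2)

/-- The arithmetic mean `z̃` of `z_1, …, z_N`. -/
def mean {N : ℕ} (z : Fin N → ℂ) : ℂ :=
  (1 / (N : ℂ)) * ∑ j, z j

/-- The elementary symmetric sum `E_{[N],n}`: the sum, over all `n`-element sets `J` of indices,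
of the products `∏_{j ∈ J} z_j`. -/
def E {N : ℕ} (n : ℕ) (z : Fin N → ℂ) : ℂ :=
  ∑ J ∈ (Finset.univ : Finset (Fin N)).powersetCard n, ∏ j ∈ J, z j

/-- The quantity `κ`. For `n ≥ 3` it is `1 / (N - 2)` times the maximum, over ordered pairs of
distinct indices `(u, v)`, of `∑_{j ∉ {u, v}} |z_j|²` (the supremum is over a finite set, which is
nonempty when `2 ≤ N`); otherwise `κ = 1`. -/
def kappa {N : ℕ} (n : ℕ) (z : Fin N → ℂ) : ℝ :=
  if 3 ≤ n then
    (1 / ((N : ℝ) - 2)) * ⨆ p : {p : Fin N × Fin N // p.1 ≠ p.2},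
      ∑ j ∈ Finset.univ \ {p.1.1, p.1.2}, ‖z j‖ ^ 2
  else 1

/-- `min {1/2, 1/(n (1 - x))}` with the convention `1/0 = ∞`, so that it is `1/2` at `x = 1`. -/
def minHalf (n : ℕ) (x : ℝ) : ℝ :=
  if x = 1 then 1 / 2 else min (1 / 2) (1 / ((n : ℝ) * (1 - x)))

end SymmMeans

end

/-!
Let `A k` be the average of the `k`-fold products over the `k`-subsets, and `m = A 1`. The proof
rests on the identity expressing `m * A (k + 1) - A (k + 2)` as `(k + 1) / (2 * N)` times the
average of `(z u - z v) ^ 2 * a k` over ordered pairs `u ≠ v`, where `a k` is `A k` with `u` and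
`v` deleted. For nonnegative reals the right side is nonnegative, which by induction gives
Maclaurin's inequality `A k ≤ m ^ k`; applied to the moduli it yields `|a k| ≤ √κ ^ k`. For complex
numbers the identity then bounds the error of replacing `A (k + 2)` by `m * A (k + 1)`, and these
errors, accumulated with the powers of `|m|` that multiply them, form `f n |m| √κ`.
-/

namespace SymmMeans

open Finset
open scoped BigOperators

lemma card_erase_erase_of_mem_offDiag {ι : Type*} [DecidableEq ι] {s : Finset ι} {p : ι × ι}
    (hp : p ∈ s.offDiag) : #((s.erase p.1).erase p.2) = #s - 2 := by
  obtain ⟨h₁, h₂, hne⟩ := mem_offDiag.1 hp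
  rw [card_erase_of_mem (mem_erase.2 ⟨hne.symm, h₂⟩), card_erase_of_mem h₁, Nat.sub_sub]

section Ring

variable {ι R : Type*} [CommRing R]

lemma cast_card_offDiag (s : Finset ι) : (#s.offDiag : R) = #s * (#s - 1) := by
  rw [offDiag_card, Nat.cast_sub (Nat.le_mul_self _)]
  push_cast
  ring

/-- The elementary symmetric sum of degree `k` of the values of `z` on `s`; `E` is the case
`s = univ`. -/
abbrev esymm (z : ι → R) (s : Finset ι) (k : ℕ) : R :=
  (s.val.map z).esymm k

variable [DecidableEq ι]

lemma esymm_succ_of_mem (z : ι → R) {s : Finset ι} {j : ι} (hj : j ∈ s) (k : ℕ) :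
    esymm z s (k + 1) = esymm z (s.erase j) (k + 1) + z j * esymm z (s.erase j) k := by
  have hs : s.val.map z = z j ::ₘ (s.erase j).val.map z := by
    rw [erase_val, ← Multiset.map_cons, Multiset.cons_erase hj]
  simp [esymm, hs, Multiset.esymm, Multiset.powersetCard_cons, Multiset.sum_map_mul_left]

lemma sum_esymm_erase (z : ι → R) (s : Finset ι) (k : ℕ) :
    ∑ j ∈ s, esymm z (s.erase j) k = ((#s : R) - k) * esymm z s k := by
  simp only [esymm_map_val]
  rw [sum_comm' (t' := s.powersetCard k) (s' := fun J => s \ J), mul_sum]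
  · refine sum_congr rfl fun J hJ => ?_
    obtain ⟨hJs, hJk⟩ := mem_powersetCard.1 hJ
    rw [sum_const, nsmul_eq_mul, cast_card_sdiff hJs, hJk]
  · intro j J
    simp only [mem_powersetCard, mem_sdiff, subset_erase]
    tauto

lemma sum_mul_esymm_erase (z : ι → R) (s : Finset ι) (k : ℕ) :
    ∑ j ∈ s, z j * esymm z (s.erase j) k = (k + 1) * esymm z s (k + 1) := by
  calc ∑ j ∈ s, z j * esymm z (s.erase j) k
      = ∑ j ∈ s, (esymm z s (k + 1) - esymm z (s.erase j) (k + 1)) :=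
        sum_congr rfl fun j hj => by rw [esymm_succ_of_mem z hj]; ring
    _ = (k + 1) * esymm z s (k + 1) := by
        rw [sum_sub_distrib, sum_esymm_erase, sum_const, nsmul_eq_mul]
        push_cast
        ring

lemma sum_sq_mul_esymm_erase (z : ι → R) (s : Finset ι) (k : ℕ) :
    ∑ j ∈ s, z j ^ 2 * esymm z (s.erase j) k
      = (∑ j ∈ s, z j) * esymm z s (k + 1) - (k + 2) * esymm z s (k + 2) := by
  calc ∑ j ∈ s, z j ^ 2 * esymm z (s.erase j) k
      = ∑ j ∈ s, (z j * esymm z s (k + 1) - z j * esymm z (s.erase j) (k + 1)) :=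
        sum_congr rfl fun j hj => by rw [esymm_succ_of_mem z hj]; ring
    _ = (∑ j ∈ s, z j) * esymm z s (k + 1) - (k + 2) * esymm z s (k + 2) := by
        rw [sum_sub_distrib, sum_mul_esymm_erase, ← sum_mul]
        push_cast
        ring

lemma sum_offDiag_mul_sub_mul_esymm (z : ι → R) (s : Finset ι) (k : ℕ) :
    ∑ p ∈ s.offDiag, z p.1 * (z p.1 - z p.2) * esymm z ((s.erase p.1).erase p.2) k
      = (#s - (k + 1)) * (∑ j ∈ s, z j) * esymm z s (k + 1)
        - (k + 2) * #s * esymm z s (k + 2) := by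
  have inner_sum : ∀ u ∈ s,
      ∑ v ∈ s.erase u, z u * (z u - z v) * esymm z ((s.erase u).erase v) k
        = (#s - (k + 1)) * (z u ^ 2 * esymm z (s.erase u) k)
          - (k + 1) * (z u * esymm z (s.erase u) (k + 1)) := by
    intro u hu
    calc ∑ v ∈ s.erase u, z u * (z u - z v) * esymm z ((s.erase u).erase v) k
        = z u ^ 2 * ∑ v ∈ s.erase u, esymm z ((s.erase u).erase v) k
          - z u * ∑ v ∈ s.erase u, z v * esymm z ((s.erase u).erase v) k := by
          rw [mul_sum, mul_sum, ← sum_sub_distrib]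
          exact sum_congr rfl fun v _ => by ring
      _ = _ := by
          rw [sum_esymm_erase, sum_mul_esymm_erase, cast_card_erase_of_mem hu]
          ring
  rw [sum_finset_product s.offDiag s (fun u => s.erase u) (by simp; tauto),
    sum_congr rfl inner_sum, sum_sub_distrib, ← mul_sum, ← mul_sum, sum_sq_mul_esymm_erase,
    sum_mul_esymm_erase]
  push_cast
  ring

lemma sum_offDiag_sub_sq_mul_esymm (z : ι → R) (s : Finset ι) (k : ℕ) :
    ∑ p ∈ s.offDiag, (z p.1 - z p.2) ^ 2 * esymm z ((s.erase p.1).erase p.2) k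
      = 2 * ((#s - (k + 1)) * (∑ j ∈ s, z j) * esymm z s (k + 1)
        - (k + 2) * #s * esymm z s (k + 2)) := by
  have swap_sum : ∑ p ∈ s.offDiag, z p.2 * (z p.2 - z p.1) * esymm z ((s.erase p.1).erase p.2) k
      = ∑ p ∈ s.offDiag, z p.1 * (z p.1 - z p.2) * esymm z ((s.erase p.1).erase p.2) k :=
    sum_equiv (Equiv.prodComm ι ι) (by simp; tauto) fun p _ => by simp [erase_right_comm]
  rw [two_mul, ← sum_offDiag_mul_sub_mul_esymm]
  nth_rw 1 [← swap_sum]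
  rw [← sum_add_distrib]
  exact sum_congr rfl fun p _ => by ring

lemma cast_choose_succ_mul (n k : ℕ) :
    (n.choose (k + 1) : R) * (k + 1) = n.choose k * (n - k) := by
  rcases le_or_gt k n with hk | hk
  · exact_mod_cast congrArg (Nat.cast : ℕ → R) (Nat.choose_succ_right_eq n k)
  · simp [Nat.choose_eq_zero_of_lt hk, Nat.choose_eq_zero_of_lt (hk.trans k.lt_succ_self)]

lemma cast_choose_add_two_mul (n k : ℕ) :
    (n.choose (k + 2) : R) * (k + 2) * (k + 1) = n * (n - 1) * (n - 2).choose k := by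
  match n with
  | 0 => simp
  | 1 => simp [Nat.choose_eq_zero_of_lt (show 1 < k + 2 by lia)]
  | n + 2 =>
    have outer : ((n + 1 + 1 : ℕ) : R) * (n + 1).choose (k + 1)
        = (n + 2).choose (k + 2) * (k + 1 + 1 : ℕ) :=
      mod_cast congrArg (Nat.cast : ℕ → R) (Nat.add_one_mul_choose_eq (n + 1) (k + 1))
    have inner : ((n + 1 : ℕ) : R) * n.choose k = (n + 1).choose (k + 1) * (k + 1 : ℕ) :=
      mod_cast congrArg (Nat.cast : ℕ → R) (Nat.add_one_mul_choose_eq n k)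
    push_cast [Nat.add_sub_cancel] at outer inner ⊢
    linear_combination (-(k : R) - 1) * outer - ((n : R) + 2) * inner

end Ring

section Field

variable {ι K : Type*} [Field K] [CharZero K]

/-- The elementary symmetric mean of degree `k` of the values of `z` on `s`: the average of the
products of `z` over the `k`-element subsets of `s`, which is `0` when `s` has fewer than `k`
elements. -/
def symmMean (z : ι → K) (s : Finset ι) (k : ℕ) : K :=
  𝔼 J ∈ s.powersetCard k, ∏ j ∈ J, z j

lemma esymm_eq_choose_mul_symmMean (z : ι → K) (s : Finset ι) (k : ℕ) :
    esymm z s k = (#s).choose k * symmMean z s k := by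
  rw [symmMean, esymm, esymm_map_val, ← card_powersetCard, card_mul_expect]

@[simp] lemma symmMean_zero (z : ι → K) (s : Finset ι) : symmMean z s 0 = 1 := by
  simp [symmMean]

lemma symmMean_one (z : ι → K) (s : Finset ι) : symmMean z s 1 = 𝔼 j ∈ s, z j := by
  simp [symmMean, powersetCard_one, expect_eq_sum_div_card]

lemma symmMean_of_card_lt (z : ι → K) {s : Finset ι} {k : ℕ} (hk : #s < k) :
    symmMean z s k = 0 := by
  rw [symmMean, powersetCard_eq_empty.2 hk, expect_empty]

variable [DecidableEq ι]

theorem expect_mul_symmMean_sub_symmMean (z : ι → K) {s : Finset ι} {k : ℕ} (hk : k + 2 ≤ #s) :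
    (𝔼 j ∈ s, z j) * symmMean z s (k + 1) - symmMean z s (k + 2)
      = (k + 1) / (2 * #s) * 𝔼 p ∈ s.offDiag,
          (z p.1 - z p.2) ^ 2 * symmMean z ((s.erase p.1).erase p.2) k := by
  set T := 𝔼 p ∈ s.offDiag, (z p.1 - z p.2) ^ 2 * symmMean z ((s.erase p.1).erase p.2) k with hT
  have sum_eq : ∑ p ∈ s.offDiag, (z p.1 - z p.2) ^ 2 * esymm z ((s.erase p.1).erase p.2) k
      = (#s - 2).choose k * (#s * (#s - 1) * T) := by
    rw [← cast_card_offDiag, hT, card_mul_expect, mul_sum]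
    refine sum_congr rfl fun p hp => ?_
    rw [esymm_eq_choose_mul_symmMean, card_erase_erase_of_mem_offDiag hp]
    ring
  have identity := sum_offDiag_sub_sq_mul_esymm z s k
  rw [sum_eq, esymm_eq_choose_mul_symmMean, esymm_eq_choose_mul_symmMean, ← card_mul_expect]
    at identity
  have choose_succ := cast_choose_succ_mul (R := K) #s (k + 1)
  push_cast at choose_succ
  have choose_add_two := cast_choose_add_two_mul (R := K) #s k
  have hs₀ : (#s : K) ≠ 0 := Nat.cast_ne_zero.2 (by lia)
  have hs₁ : (#s : K) - 1 ≠ 0 := sub_ne_zero.2 (Nat.cast_ne_one.2 (by lia))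
  have hchoose : ((#s - 2).choose k : K) ≠ 0 :=
    Nat.cast_ne_zero.2 (Nat.choose_pos (by lia)).ne'
  rw [div_mul_eq_mul_div, eq_div_iff (mul_ne_zero two_ne_zero hs₀)]
  refine mul_left_cancel₀ (mul_ne_zero (mul_ne_zero hs₀ hs₁) hchoose) ?_
  linear_combination -((k : K) + 1) * identity
    + 2 * #s * (k + 1) * (𝔼 j ∈ s, z j) * symmMean z s (k + 1) * choose_succ
    - 2 * #s * ((𝔼 j ∈ s, z j) * symmMean z s (k + 1) - symmMean z s (k + 2)) * choose_add_two

end Field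

section OrderedField

variable {ι K : Type*} [Field K] [LinearOrder K] [IsStrictOrderedRing K] {x : ι → K}
  {s : Finset ι}

lemma symmMean_nonneg (hx : ∀ j ∈ s, 0 ≤ x j) (k : ℕ) : 0 ≤ symmMean x s k :=
  expect_nonneg fun _ hJ => prod_nonneg fun j hj => hx j ((mem_powersetCard.1 hJ).1 hj)

lemma symmMean_add_two_le (hx : ∀ j ∈ s, 0 ≤ x j) (k : ℕ) :
    symmMean x s (k + 2) ≤ (𝔼 j ∈ s, x j) * symmMean x s (k + 1) := by
  classical
  rcases lt_or_ge #s (k + 2) with hk | hk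
  · rw [symmMean_of_card_lt x hk]
    exact mul_nonneg (expect_nonneg hx) (symmMean_nonneg hx _)
  · rw [← sub_nonneg, expect_mul_symmMean_sub_symmMean x hk]
    exact mul_nonneg (by positivity) <| expect_nonneg fun p _ =>
      mul_nonneg (sq_nonneg _) (symmMean_nonneg (fun j hj => hx j (by simp_all)) k)

theorem symmMean_le_expect_pow (hx : ∀ j ∈ s, 0 ≤ x j) :
    ∀ k, symmMean x s k ≤ (𝔼 j ∈ s, x j) ^ k
  | 0 => by simp
  | 1 => by rw [symmMean_one, pow_one]
  | k + 2 => calc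
      symmMean x s (k + 2) ≤ (𝔼 j ∈ s, x j) * symmMean x s (k + 1) := symmMean_add_two_le hx k
      _ ≤ (𝔼 j ∈ s, x j) * (𝔼 j ∈ s, x j) ^ (k + 1) :=
        mul_le_mul_of_nonneg_left (symmMean_le_expect_pow hx (k + 1)) (expect_nonneg hx)
      _ = (𝔼 j ∈ s, x j) ^ (k + 2) := (pow_succ' _ _).symm

end OrderedField

section Coefficient

variable {x y : ℝ}

lemma f_succ (n : ℕ) (x y : ℝ) : f (n + 1) x y = x * f n x y + n * y ^ (n - 1) := by
  rcases n.eq_zero_or_pos with rfl | hn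
  · simp [f]
  unfold f
  rw [sum_Icc_succ_top (by lia), mul_sum]
  congr 1
  · refine sum_congr rfl fun k hk => ?_
    rw [Nat.sub_add_comm (mem_Icc.1 hk).2, pow_succ]
    ring
  · simp

lemma f_le_choose_two (hx₀ : 0 ≤ x) (hx₁ : x ≤ 1) (hy₀ : 0 ≤ y) (hy₁ : y ≤ 1) (n : ℕ) :
    f n x y ≤ n.choose 2 := by
  induction n with
  | zero => simp [f]
  | succ n ih =>
    calc f (n + 1) x y = x * f n x y + n * y ^ (n - 1) := f_succ n x y
      _ ≤ x * n.choose 2 + n * 1 := by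
        gcongr
        exact pow_le_one₀ hy₀ hy₁
      _ ≤ 1 * n.choose 2 + n * 1 := by gcongr
      _ = (n + 1).choose 2 := by
        rw [Nat.choose_succ_succ' n 1, Nat.choose_one_right]
        push_cast
        ring

lemma one_sub_mul_f_succ_le (hx₀ : 0 ≤ x) (hx₁ : x ≤ 1) (hy₀ : 0 ≤ y) (hy₁ : y ≤ 1) (n : ℕ) :
    (1 - x) * f (n + 1) x y ≤ n := by
  induction n with
  | zero => simp [f]
  | succ n ih =>
    have : 0 ≤ 1 - x := sub_nonneg.2 hx₁
    calc (1 - x) * f (n + 2) x y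
        = x * ((1 - x) * f (n + 1) x y) + (1 - x) * ((n + 1 : ℕ) * y ^ n) := by
          rw [f_succ (n + 1), Nat.add_sub_cancel]
          ring
      _ ≤ x * n + (1 - x) * ((n + 1 : ℕ) * 1) := by
          gcongr
          exact pow_le_one₀ hy₀ hy₁
      _ ≤ (n + 1 : ℕ) := by
          push_cast
          linarith

lemma f_le_mul_minHalf (hx₀ : 0 ≤ x) (hx₁ : x ≤ 1) (hy₀ : 0 ≤ y) (hy₁ : y ≤ 1) {n : ℕ}
    (hn : 1 ≤ n) : f n x y ≤ n * (n - 1) * minHalf n x := by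
  have le_half : f n x y ≤ n * (n - 1) * (1 / 2) := by
    rw [mul_one_div, ← Nat.cast_choose_two]
    exact f_le_choose_two hx₀ hx₁ hy₀ hy₁ n
  unfold minHalf
  split_ifs with hx
  · exact le_half
  obtain ⟨m, rfl⟩ := Nat.exists_eq_add_of_le' hn
  have hsub : 0 < 1 - x := sub_pos.2 (hx₁.lt_of_ne hx)
  have le_inv : f (m + 1) x y
      ≤ (m + 1 : ℕ) * ((m + 1 : ℕ) - 1) * (1 / ((m + 1 : ℕ) * (1 - x))) := by
    rw [mul_one_div, mul_div_mul_left _ _ (by positivity), le_div_iff₀' hsub]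
    simpa using one_sub_mul_f_succ_le hx₀ hx₁ hy₀ hy₁ m
  rcases min_choice (1 / 2 : ℝ) (1 / ((m + 1 : ℕ) * (1 - x))) with h | h <;> rw [h]
  exacts [le_half, le_inv]

end Coefficient

section RCLike

variable {ι 𝕜 : Type*} [RCLike 𝕜]

lemma norm_symmMean_le (z : ι → 𝕜) (s : Finset ι) (k : ℕ) :
    ‖symmMean z s k‖ ≤ symmMean (fun j => ‖z j‖) s k := by
  simpa only [symmMean, norm_prod] using
    RCLike.norm_expect_le (K := 𝕜) (s := s.powersetCard k) (f := fun J => ∏ j ∈ J, z j)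

lemma norm_symmMean_le_sqrt_pow (z : ι → 𝕜) (s : Finset ι) (k : ℕ) :
    ‖symmMean z s k‖ ≤ √(𝔼 j ∈ s, ‖z j‖ ^ 2) ^ k := by
  have mean_le_sqrt : 𝔼 j ∈ s, ‖z j‖ ≤ √(𝔼 j ∈ s, ‖z j‖ ^ 2) := by
    simp only [expect_eq_sum_div_card]
    exact Real.le_sqrt_of_sq_le sum_div_card_sq_le_sum_sq_div_card
  calc ‖symmMean z s k‖ ≤ symmMean (fun j => ‖z j‖) s k := norm_symmMean_le z s k
    _ ≤ (𝔼 j ∈ s, ‖z j‖) ^ k := symmMean_le_expect_pow (fun j _ => norm_nonneg (z j)) k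
    _ ≤ √(𝔼 j ∈ s, ‖z j‖ ^ 2) ^ k :=
      pow_le_pow_left₀ (expect_nonneg fun j _ => norm_nonneg (z j)) mean_le_sqrt k

variable (𝕜) in
lemma sum_offDiag_norm_sub_sq_of_sum_eq_zero {F : Type*} [NormedAddCommGroup F]
    [InnerProductSpace 𝕜 F] {s : Finset ι} {w : ι → F} (hw : ∑ j ∈ s, w j = 0) :
    ∑ p ∈ s.offDiag, ‖w p.1 - w p.2‖ ^ 2 = 2 * #s * ∑ j ∈ s, ‖w j‖ ^ 2 := by
  have offDiag_eq : ∑ p ∈ s.offDiag, ‖w p.1 - w p.2‖ ^ 2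
      = ∑ u ∈ s, ∑ v ∈ s, ‖w u - w v‖ ^ 2 := by
    rw [← sum_product']
    refine sum_subset (fun p hp => ?_) fun p hp hdiag => ?_
    · exact mem_product.2 ⟨(mem_offDiag.1 hp).1, (mem_offDiag.1 hp).2.1⟩
    · simp_all
  have inner_sum (u : ι) : ∑ v ∈ s, ‖w u - w v‖ ^ 2 = #s * ‖w u‖ ^ 2 + ∑ v ∈ s, ‖w v‖ ^ 2 := by
    have cross : ∑ v ∈ s, RCLike.re (inner 𝕜 (w u) (w v)) = 0 := by
      rw [← map_sum, ← inner_sum, hw, inner_zero_right, map_zero]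
    simp only [norm_sub_sq (𝕜 := 𝕜), sum_add_distrib, sum_sub_distrib, ← mul_sum, cross,
      sum_const, nsmul_eq_mul]
    ring
  rw [offDiag_eq]
  simp only [inner_sum, sum_add_distrib, ← mul_sum, sum_const, nsmul_eq_mul]
  ring

lemma sum_offDiag_norm_sub_sq (z : ι → 𝕜) (s : Finset ι) :
    ∑ p ∈ s.offDiag, ‖z p.1 - z p.2‖ ^ 2
      = 2 * #s * ∑ j ∈ s, ‖z j - 𝔼 i ∈ s, z i‖ ^ 2 := by
  have centered : ∑ j ∈ s, (z j - 𝔼 i ∈ s, z i) = 0 := by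
    rw [sum_sub_distrib, sum_const, card_smul_expect, sub_self]
  rw [← sum_offDiag_norm_sub_sq_of_sum_eq_zero 𝕜 centered]
  simp only [sub_sub_sub_cancel_right]

variable [DecidableEq ι]

lemma norm_symmMean_sub_expect_mul_le (z : ι → 𝕜) {s : Finset ι} {k : ℕ} {c : ℝ}
    (hk : k + 2 ≤ #s)
    (hc : ∀ p ∈ s.offDiag, ‖symmMean z ((s.erase p.1).erase p.2) k‖ ≤ c) :
    ‖symmMean z s (k + 2) - (𝔼 j ∈ s, z j) * symmMean z s (k + 1)‖
      ≤ (k + 1) * c * ((∑ j ∈ s, ‖z j - 𝔼 i ∈ s, z i‖ ^ 2) / (#s * (#s - 1))) := by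
  have hs : (#s : ℝ) ≠ 0 := Nat.cast_ne_zero.2 (by lia)
  have expect_bound : ‖𝔼 p ∈ s.offDiag, (z p.1 - z p.2) ^ 2
        * symmMean z ((s.erase p.1).erase p.2) k‖
      ≤ 𝔼 p ∈ s.offDiag, ‖z p.1 - z p.2‖ ^ 2 * c := by
    refine (RCLike.norm_expect_le (K := 𝕜)).trans (expect_le_expect fun p hp => ?_)
    rw [norm_mul, norm_pow]
    exact mul_le_mul_of_nonneg_left (hc p hp) (by positivity)
  have norm_coeff : ‖((k : 𝕜) + 1) / (2 * #s)‖ = (k + 1) / (2 * #s) := by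
    rw [norm_div, norm_mul, RCLike.norm_ofNat, RCLike.norm_natCast, ← Nat.cast_add_one,
      RCLike.norm_natCast, Nat.cast_add_one]
  rw [norm_sub_rev, expect_mul_symmMean_sub_symmMean z hk, norm_mul, norm_coeff]
  calc ((k : ℝ) + 1) / (2 * #s) * ‖𝔼 p ∈ s.offDiag, (z p.1 - z p.2) ^ 2
        * symmMean z ((s.erase p.1).erase p.2) k‖
      ≤ (k + 1) / (2 * #s) * 𝔼 p ∈ s.offDiag, ‖z p.1 - z p.2‖ ^ 2 * c := by gcongr
    _ = (k + 1) * c * ((∑ j ∈ s, ‖z j - 𝔼 i ∈ s, z i‖ ^ 2) / (#s * (#s - 1))) := by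
      rw [← expect_mul, expect_eq_sum_div_card, sum_offDiag_norm_sub_sq, cast_card_offDiag]
      field_simp

theorem norm_symmMean_sub_expect_pow_le (z : ι → 𝕜) {s : Finset ι} {r : ℝ} {n : ℕ} (hn : n ≤ #s)
    (hr : ∀ k, k + 2 ≤ n →
      ∀ p ∈ s.offDiag, ‖symmMean z ((s.erase p.1).erase p.2) k‖ ≤ r ^ k) :
    ‖symmMean z s n - (𝔼 j ∈ s, z j) ^ n‖
      ≤ f n ‖𝔼 j ∈ s, z j‖ r
        * ((∑ j ∈ s, ‖z j - 𝔼 i ∈ s, z i‖ ^ 2) / (#s * (#s - 1))) := by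
  set m := 𝔼 j ∈ s, z j with hm
  set V := (∑ j ∈ s, ‖z j - m‖ ^ 2) / (#s * (#s - 1) : ℝ)
  induction n with
  | zero => simp [f]
  | succ n ih =>
    rcases n with _ | k
    · simp [f, symmMean_one, hm]
    · have ih := ih (by lia) fun k hk => hr k (by lia)
      calc ‖symmMean z s (k + 2) - m ^ (k + 2)‖
          = ‖(symmMean z s (k + 2) - m * symmMean z s (k + 1))
              + m * (symmMean z s (k + 1) - m ^ (k + 1))‖ := by congr 1; ring
        _ ≤ ‖symmMean z s (k + 2) - m * symmMean z s (k + 1)‖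
              + ‖m‖ * ‖symmMean z s (k + 1) - m ^ (k + 1)‖ := by
          rw [← norm_mul]
          exact norm_add_le _ _
        _ ≤ (k + 1) * r ^ k * V + ‖m‖ * (f (k + 1) ‖m‖ r * V) := by
          gcongr
          exact norm_symmMean_sub_expect_mul_le z hn (hr k le_rfl)
        _ = f (k + 2) ‖m‖ r * V := by
          rw [f_succ (k + 1)]
          push_cast [Nat.add_sub_cancel]
          ring

end RCLike

section Complex

variable {N : ℕ}

lemma mean_eq_expect (z : Fin N → ℂ) : mean z = 𝔼 j, z j := by
  rw [mean, one_div_mul_eq_div, Fintype.expect_eq_sum_div_card, Fintype.card_fin]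

lemma symmMean_univ (z : Fin N → ℂ) (n : ℕ) :
    symmMean z univ n = 1 / (N.choose n : ℂ) * E n z := by
  rw [symmMean, expect_eq_sum_div_card, card_powersetCard, card_fin, one_div_mul_eq_div, E]

lemma norm_mean_le_one {z : Fin N → ℂ} (hz : ∀ j, ‖z j‖ ≤ 1) : ‖mean z‖ ≤ 1 := by
  rw [mean_eq_expect]
  rcases N.eq_zero_or_pos with rfl | hN
  · simp
  · have : Nonempty (Fin N) := ⟨⟨0, hN⟩⟩
    exact (RCLike.norm_expect_le (K := ℂ)).trans (expect_le univ_nonempty fun j _ => hz j)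

lemma univ_sdiff_pair_eq_erase_erase (u v : Fin N) :
    univ \ {u, v} = ((univ : Finset (Fin N)).erase u).erase v := by
  ext j
  simp [and_comm]

lemma expect_norm_sq_le_kappa {n : ℕ} (hn : 3 ≤ n) (hnN : n ≤ N) (z : Fin N → ℂ)
    {p : Fin N × Fin N} (hp : p ∈ univ.offDiag) :
    𝔼 j ∈ (univ.erase p.1).erase p.2, ‖z j‖ ^ 2 ≤ kappa n z := by
  have hcard : (#((univ.erase p.1).erase p.2) : ℝ) = N - 2 := by
    rw [card_erase_erase_of_mem_offDiag hp, card_fin, Nat.cast_sub (by lia), Nat.cast_two]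
  have hN : (0 : ℝ) ≤ 1 / (N - 2) := by
    rw [← hcard]
    positivity
  rw [kappa, if_pos hn, expect_eq_sum_div_card, hcard, ← univ_sdiff_pair_eq_erase_erase,
    ← one_div_mul_eq_div]
  exact mul_le_mul_of_nonneg_left
    (le_ciSup (f := fun p : {p : Fin N × Fin N // p.1 ≠ p.2} =>
      ∑ j ∈ univ \ {p.1.1, p.1.2}, ‖z j‖ ^ 2) (Set.finite_range _).bddAbove
      ⟨p, (mem_offDiag.1 hp).2.2⟩) hN

lemma norm_symmMean_erase_erase_le {n k : ℕ} (hnN : n ≤ N) (hk : k + 2 ≤ n) (z : Fin N → ℂ)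
    {p : Fin N × Fin N} (hp : p ∈ univ.offDiag) :
    ‖symmMean z ((univ.erase p.1).erase p.2) k‖ ≤ √(kappa n z) ^ k := by
  rcases k.eq_zero_or_pos with rfl | hk₀
  · simp
  · refine (norm_symmMean_le_sqrt_pow z _ k).trans ?_
    gcongr
    exact expect_norm_sq_le_kappa (by lia) hnN z hp

lemma kappa_le_one {n : ℕ} (hnN : n ≤ N) {z : Fin N → ℂ} (hz : ∀ j, ‖z j‖ ≤ 1) :
    kappa n z ≤ 1 := by
  unfold kappa
  split_ifs with hn
  · have hN : (3 : ℝ) ≤ N := mod_cast hn.trans hnN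
    rw [one_div_mul_eq_div, div_le_one (by linarith)]
    refine Real.iSup_le (fun p => ?_) (by linarith)
    calc ∑ j ∈ univ \ {p.1.1, p.1.2}, ‖z j‖ ^ 2
        ≤ ∑ _j ∈ univ \ {p.1.1, p.1.2}, (1 : ℝ) :=
          sum_le_sum fun j _ => pow_le_one₀ (norm_nonneg _) (hz j)
      _ = N - 2 := by
        rw [sum_const, card_sdiff_of_subset (subset_univ _), card_pair p.2, card_fin, nsmul_one,
          Nat.cast_sub (by lia), Nat.cast_two]
  · exact le_rfl

end Complex

end SymmMeans

open SymmMeans in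
theorem mainTheorem9_general (n N : ℕ) (hn : 2 ≤ n) (hnN : n ≤ N) (z : Fin N → ℂ) :
    ‖(1 / (N.choose n : ℂ)) * E n z - mean z ^ n‖
        ≤ f n ‖mean z‖ √(kappa n z) / ((N : ℝ) * ((N : ℝ) - 1)) * ∑ j, ‖z j - mean z‖ ^ 2
    ∧ (‖mean z‖ ≤ 1 → kappa n z ≤ 1 →
      f n ‖mean z‖ √(kappa n z) / ((N : ℝ) * ((N : ℝ) - 1)) * ∑ j, ‖z j - mean z‖ ^ 2
        ≤ ((n : ℝ) * ((n : ℝ) - 1)) / ((N : ℝ) * ((N : ℝ) - 1))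
            * (∑ j, ‖z j - mean z‖ ^ 2) * minHalf n ‖mean z‖) := by
  rw [div_mul_eq_mul_div (f _ _ _), mul_div_assoc (f _ _ _)]
  set V := (∑ j, ‖z j - mean z‖ ^ 2) / ((N : ℝ) * ((N : ℝ) - 1))
  refine ⟨?_, fun hmean hkappa => ?_⟩
  · have bound := norm_symmMean_sub_expect_pow_le z (s := Finset.univ) (by simpa using hnN)
      fun k hk p => norm_symmMean_erase_erase_le hnN hk z
    simpa only [symmMean_univ, ← mean_eq_expect, Finset.card_fin] using bound
  · have hV₀ : 0 ≤ V := by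
      have hN : (2 : ℝ) ≤ N := mod_cast hn.trans hnN
      have : 0 ≤ (N : ℝ) - 1 := by linarith
      positivity
    calc f n ‖mean z‖ √(kappa n z) * V ≤ n * (n - 1) * minHalf n ‖mean z‖ * V :=
          mul_le_mul_of_nonneg_right (f_le_mul_minHalf (norm_nonneg _) hmean (Real.sqrt_nonneg _)
            (Real.sqrt_le_one.2 hkappa) (by lia)) hV₀
      _ = _ := by ring

theorem mainTheorem9 (n N : ℕ) (hn : 2 ≤ n) (hnN : n ≤ N) (z : Fin N → ℂ)
    (hz : ∀ j, ‖z j‖ ≤ 1) :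
    ‖(1 / (N.choose n : ℂ)) * SymmMeans.E n z - SymmMeans.mean z ^ n‖
        ≤ SymmMeans.f n ‖SymmMeans.mean z‖ (Real.sqrt (SymmMeans.kappa n z))
            / ((N : ℝ) * ((N : ℝ) - 1)) * ∑ j, ‖z j - SymmMeans.mean z‖ ^ 2
    ∧ SymmMeans.f n ‖SymmMeans.mean z‖ (Real.sqrt (SymmMeans.kappa n z))
            / ((N : ℝ) * ((N : ℝ) - 1)) * ∑ j, ‖z j - SymmMeans.mean z‖ ^ 2
        ≤ ((n : ℝ) * ((n : ℝ) - 1)) / ((N : ℝ) * ((N : ℝ) - 1))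
            * (∑ j, ‖z j - SymmMeans.mean z‖ ^ 2)
            * SymmMeans.minHalf n ‖SymmMeans.mean z‖ :=
  (mainTheorem9_general n N hn hnN z).imp_right fun h =>
    h (SymmMeans.norm_mean_le_one hz) (SymmMeans.kappa_le_one hnN hz)
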